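/- Let $(X,d)$ be a compact metric space, $f:X\to X$ a homeomorphism and $\tau:X\to(0,+\infty)$ a continuous function. Let $X^{\tau,f}=\{(x,s): x\in X,\ 0\le s\le\tau(x)\}/\sim$, where $\sim$ is the equivalence relation generated by $(x,\tau(x))\sim(f(x),0)$ for all $x\in X$, and let $\phi^{\tau,f}$ be the suspension flow on $X^{\tau,f}$, that is, the flow with $\phi^{\tau,f}_t(x,s)=(x,s+t)$ whenever $s,\,s+t\in[0,\tau(x)]$. Equip $X^{\tau,f}$ with the Bowen–Walters metric $d^{\tau,f}$: the distance of two points is the infimum of the lengths of the finite chains joining them, where a chain consists of horizontal segments from $(x,u\tau(x))$ to $(y,u\tau(y))$ of length $(1-u)\,d(x,y)+u\,d(f(x),f(y))$ and vertical segments from $(x,u\tau(x))$ to $(x,v\tau(x))$ of length $|u-v|$, with $x,y\in X$ and $u,v\in[0,1]$. A point $p\in X$ is shadowable for $f$ if for every $\varepsilon>0$ there is $\delta>0$ such that for every sequence $(x_n)_{n\in\mathbb Z}$ in $X$ with $x_0=p$ and $d(f(x_n),x_{n+1})\le\delta$ for all $n\in\mathbb Z$ there is $q\in X$ with $d(f^n(q),x_n)\le\varepsilon$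 for all $n\in\mathbb Z$. Let $Sh(f)$ be the set of these points. Given a flow $\phi$ on a metric space $(Y,\rho)$, a point $p\in Y$ is shadowable for $\phi$ if for every $\varepsilon>0$ there is $\delta>0$ such that for every sequence $(x_i,t_i)_{i\in\mathbb Z}$ in $Y\times\mathbb R$ with $x_0=p$, $t_i\ge1$ and $\rho(\phi_{t_i}(x_i),x_{i+1})\le\delta$ for all $i\in\mathbb Z$ there are $y\in Y$ and a strictly increasing surjection $h:\mathbb R\to\mathbb R$ with $h(0)=0$ such that $$\rho\bigl(\phi_{t-s_i}(x_i),\,\phi_{h(t)}(y)\bigr)\le\varepsilon\quad\text{whenever } i\in\mathbb Z \text{ and } s_i\le t<s_{i+1},$$ where $s_0=0$, $s_i=\sum_{j=0}^{i-1}t_j$ for $i>0$ and $s_i=-\sum_{j=i}^{-1}t_j$ for $i<0$. Let $Sh(\phi)$ be the set of these points. Then the shadowable points of the suspension flow are exactly the points over the shadowable points of $f$: $$Sh(\phi^{\tau,f})=\{(x,s): x\in Sh(f),\ 0\le s\le\tau(x)\}/\sim .$$ -/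

import Mathlib

/-- The sums associated to a bi-infinite sequence of real numbers: `t 0 + ⋯ + t (i - 1)` for
`i > 0`, zero for `i = 0`, and `-(t i + ⋯ + t (-1))` for `i < 0`. -/
noncomputable def sumSeq (t : ℤ → ℝ) (i : ℤ) : ℝ :=
  ∑ j ∈ Finset.Ico 0 i, t j - ∑ j ∈ Finset.Ico i 0, t j

theorem sumSeq_zero (t : ℤ → ℝ) : sumSeq t 0 = 0 := by
  simp [sumSeq]

theorem sumSeq_succ (t : ℤ → ℝ) (i : ℤ) : sumSeq t (i + 1) = sumSeq t i + t i := by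
  unfold sumSeq
  rcases le_or_gt 0 i with hi | hi
  · have e1 : Finset.Ico (i + 1) 0 = ∅ := Finset.Ico_eq_empty (by lia)
    have e2 : Finset.Ico i 0 = ∅ := Finset.Ico_eq_empty (by lia)
    have e3 : Finset.Ico 0 (i + 1) = insert i (Finset.Ico 0 i) := by
      ext j; simp only [Finset.mem_Ico, Finset.mem_insert]; lia
    rw [e1, e2, e3, Finset.sum_insert (by simp)]
    simp [add_comm]
  · have e1 : Finset.Ico 0 (i + 1) = ∅ := Finset.Ico_eq_empty (by lia)
    have e2 : Finset.Ico 0 i = ∅ := Finset.Ico_eq_empty (by lia)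
    have e3 : Finset.Ico i 0 = insert i (Finset.Ico (i + 1) 0) := by
      ext j; simp only [Finset.mem_Ico, Finset.mem_insert]; lia
    rw [e1, e2, e3, Finset.sum_insert (by simp)]
    simp

theorem sumSeq_strictMono {t : ℤ → ℝ} (ht : ∀ j, 0 < t j) : StrictMono (sumSeq t) :=
  strictMono_int_of_lt_succ fun i => by rw [sumSeq_succ]; linarith [ht i]

theorem sumSeq_exists {t : ℤ → ℝ} {c : ℝ} (hc : 0 < c) (ht : ∀ j, c ≤ t j) (s : ℝ) :
    ∃ n : ℤ, sumSeq t n ≤ s ∧ s < sumSeq t (n + 1) := by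
  have hmono := sumSeq_strictMono fun j => hc.trans_le (ht j)
  have hup : ∀ n : ℕ, n * c ≤ sumSeq t n := by
    intro n
    induction n with
    | zero => simp [sumSeq_zero]
    | succ k ih => push_cast; rw [sumSeq_succ]; linarith [ht k]
  have hdown : ∀ n : ℕ, sumSeq t (-n) ≤ -(n * c) := by
    intro n
    induction n with
    | zero => simp [sumSeq_zero]
    | succ k ih =>
      have h := sumSeq_succ t (-((k + 1 : ℕ) : ℤ))
      have e : -((k + 1 : ℕ) : ℤ) + 1 = -(k : ℤ) := by push_cast; ring
      rw [e] at h
      push_cast at h ⊢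
      have := ht (-((k : ℤ) + 1))
      linarith
  obtain ⟨a, ha⟩ := Archimedean.arch s hc
  obtain ⟨b, hb⟩ := Archimedean.arch (-s) hc
  rw [nsmul_eq_mul] at ha hb
  obtain ⟨n, hn, hmax⟩ := Int.exists_greatest_of_bdd (P := fun n => sumSeq t n ≤ s)
    ⟨a + 1, fun z hz => by
      by_contra hlt
      have h1 := hmono.monotone (le_of_not_ge hlt)
      rw [sumSeq_succ] at h1
      linarith [hup a, ht a]⟩ ⟨-b, by linarith [hdown b]⟩
  refine ⟨n, hn, ?_⟩
  by_contra h
  have := hmax (n + 1) (not_lt.mp h)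
  lia

theorem sumSeq_unique {t : ℤ → ℝ} (ht : ∀ j, 0 < t j) {s : ℝ} {n m : ℤ}
    (hn : sumSeq t n ≤ s) (hn' : s < sumSeq t (n + 1))
    (hm : sumSeq t m ≤ s) (hm' : s < sumSeq t (m + 1)) : n = m := by
  have hmono := sumSeq_strictMono ht
  have h1 := hmono.lt_iff_lt.mp (hn.trans_lt hm')
  have h2 := hmono.lt_iff_lt.mp (hm.trans_lt hn')
  lia

/-! ### Shadowable points of a homeomorphism -/

/-- `x` is a `δ`-pseudo-orbit of the homeomorphism `f`. -/
def IsPseudoOrbit {X : Type*} [MetricSpace X] (f : X ≃ₜ X) (δ : ℝ) (x : ℤ → X) : Prop :=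
  ∀ n : ℤ, dist (f (x n)) (x (n + 1)) ≤ δ

/-- The set `Sh(f)` of shadowable points of the homeomorphism `f`. -/
def shadowableSet {X : Type*} [MetricSpace X] (f : X ≃ₜ X) : Set X :=
  {p | ∀ ε > 0, ∃ δ > 0, ∀ x : ℤ → X, IsPseudoOrbit f δ x → x 0 = p →
    ∃ q : X, ∀ n : ℤ, dist ((f ^ n) q) (x n) ≤ ε}

/-! ### Shadowable points of a flow -/

/-- A flow on `Y`: an action of the additive group of real numbers. -/
structure RealFlow (Y : Type*) where
  /-- The time `t` map. -/
  toFun : ℝ → Y → Y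
  map_zero : ∀ y, toFun 0 y = y
  map_add : ∀ s t y, toFun t (toFun s y) = toFun (s + t) y

namespace RealFlow

/-- `(x i, t i)` is a `(δ, T)`-pseudo-orbit of the flow. -/
def IsPseudoOrbit {Y : Type*} [Dist Y] (φ : RealFlow Y) (δ T : ℝ) (x : ℤ → Y) (t : ℤ → ℝ) :
    Prop :=
  ∀ i : ℤ, T ≤ t i ∧ dist (φ.toFun (t i) (x i)) (x (i + 1)) ≤ δ

/-- A reparametrization: a strictly increasing surjection of the line that fixes `0`. -/
def IsRep (h : ℝ → ℝ) : Prop :=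
  StrictMono h ∧ Function.Surjective h ∧ h 0 = 0

/-- The sequence `(x i, t i)` is `ε`-shadowed by an orbit of the flow. The point at time `r` on
the pseudo-orbit is `φ_{r - s_i} (x i)`, where `s_i ≤ r < s_{i+1}`. -/
def IsShadowed {Y : Type*} [Dist Y] (φ : RealFlow Y) (ε : ℝ) (x : ℤ → Y) (t : ℤ → ℝ) : Prop :=
  ∃ (y : Y) (h : ℝ → ℝ), IsRep h ∧ ∀ (r : ℝ) (i : ℤ), sumSeq t i ≤ r → r < sumSeq t (i + 1) →
    dist (φ.toFun (r - sumSeq t i) (x i)) (φ.toFun (h r) y) ≤ ε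

/-- The set `Sh(φ)` of shadowable points of the flow (with respect to the parameter `T = 1`). -/
def shadowableSet {Y : Type*} [Dist Y] (φ : RealFlow Y) : Set Y :=
  {p | ∀ ε > 0, ∃ δ > 0, ∀ (x : ℤ → Y) (t : ℤ → ℝ), φ.IsPseudoOrbit δ 1 x t → x 0 = p →
    φ.IsShadowed ε x t}

end RealFlow

/-! ### The suspension -/

section Suspension

/-- The region `{(x, t) : 0 ≤ t ≤ τ x}` under the graph of the roof function. -/
def UnderRoof {X : Type*} [TopologicalSpace X] (τ : C(X, Set.Ioi (0 : ℝ))) : Type _ :=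
  {q : X × ℝ // 0 ≤ q.2 ∧ q.2 ≤ (τ q.1 : ℝ)}

/-- The identification `(x, τ x) ∼ (f x, 0)`. -/
def RoofGlue {X : Type*} [TopologicalSpace X] (f : X ≃ₜ X) (τ : C(X, Set.Ioi (0 : ℝ)))
    (q q' : UnderRoof τ) : Prop :=
  q.1.2 = (τ q.1.1 : ℝ) ∧ q'.1.1 = f q.1.1 ∧ q'.1.2 = 0

/-- The suspension `X^{τ,f}`: the region under the roof modulo the equivalence relation that is
generated by `(x, τ x) ∼ (f x, 0)`. -/
def Suspension {X : Type*} [TopologicalSpace X] (f : X ≃ₜ X) (τ : C(X, Set.Ioi (0 : ℝ))) :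
    Type _ :=
  Quot (RoofGlue f τ)

namespace Suspension

/-- The class of the point `(x, s)`, where `0 ≤ s ≤ τ x`. -/
def mk {X : Type*} [TopologicalSpace X] (f : X ≃ₜ X) (τ : C(X, Set.Ioi (0 : ℝ)))
    (x : X) (s : ℝ) (h0 : 0 ≤ s) (h1 : s ≤ τ x) : Suspension f τ :=
  Quot.mk _ ⟨(x, s), h0, h1⟩

/-- The class of `(x, u τ(x))`, where `0 ≤ u ≤ 1`. -/
def atHeight {X : Type*} [TopologicalSpace X] (f : X ≃ₜ X) (τ : C(X, Set.Ioi (0 : ℝ)))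
    (x : X) (u : Set.Icc (0 : ℝ) 1) : Suspension f τ :=
  mk f τ x (u * τ x) (mul_nonneg u.2.1 (le_of_lt (τ x).2))
    (mul_le_of_le_one_left (le_of_lt (τ x).2) u.2.2)

/-! #### The suspension flow -/

/-- `crossing f τ x n` is the time at which the orbit of `(x, 0)` reaches `(f^n x, 0)`:
`τ x + τ (f x) + ⋯ + τ (f^{n-1} x)` for `n ≥ 0`, and `-(τ (f^{-1} x) + ⋯ + τ (f^n x))` for
`n ≤ 0`. -/
noncomputable def crossing {X : Type*} [TopologicalSpace X] (f : X ≃ₜ X) (τ : C(X, Set.Ioi (0 : ℝ)))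
    (x : X) : ℤ → ℝ :=
  sumSeq fun j => (τ ((f ^ j) x) : ℝ)

theorem exists_crossing {X : Type*} [TopologicalSpace X] [CompactSpace X] (f : X ≃ₜ X)
    (τ : C(X, Set.Ioi (0 : ℝ))) (x : X) (s : ℝ) :
    ∃ n : ℤ, crossing f τ x n ≤ s ∧ s < crossing f τ x (n + 1) := by
  obtain ⟨z, -, hz⟩ := isCompact_univ.exists_isMinOn (f := fun y => (τ y : ℝ)) ⟨x, trivial⟩
    (continuous_subtype_val.comp τ.continuous).continuousOn
  exact sumSeq_exists (c := (τ z : ℝ)) (τ z).2 (fun j => hz (Set.mem_univ _)) s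

theorem crossing_succ {X : Type*} [TopologicalSpace X] (f : X ≃ₜ X) (τ : C(X, Set.Ioi (0 : ℝ)))
    (x : X) (n : ℤ) : crossing f τ x (n + 1) = crossing f τ x n + τ ((f ^ n) x) :=
  sumSeq_succ _ n

theorem crossing_shift {X : Type*} [TopologicalSpace X] (f : X ≃ₜ X) (τ : C(X, Set.Ioi (0 : ℝ)))
    (x : X) (n : ℤ) : crossing f τ x (n + 1) = τ x + crossing f τ (f x) n := by
  have step : ∀ m : ℤ, (f ^ m) (f x) = (f ^ (m + 1)) x := fun m => by
    rw [zpow_add_one]; rfl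
  induction n using Int.induction_on with
  | zero =>
    rw [crossing_succ]
    simp [crossing, sumSeq_zero]
  | succ i ih =>
    rw [crossing_succ, ih, crossing_succ f τ (f x), step]; ring
  | pred i ih =>
    have h1 := crossing_succ f τ x (-(i : ℤ) - 1 + 1)
    have h2 := crossing_succ f τ (f x) (-(i : ℤ) - 1)
    rw [step] at h2
    rw [sub_add_cancel] at h1 h2 ⊢
    linarith

/-- The point reached by following the suspension flow from `(x, 0)` for time `s`. It is
`(f^n x, s - S_n)`, where `S_n` is the `n`-th crossing time of `x` and `S_n ≤ s < S_{n+1}`. -/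
noncomputable def wrap {X : Type*} [TopologicalSpace X] [CompactSpace X] (f : X ≃ₜ X)
    (τ : C(X, Set.Ioi (0 : ℝ))) (x : X) (s : ℝ) : Suspension f τ :=
  mk f τ ((f ^ (exists_crossing f τ x s).choose) x)
    (s - crossing f τ x (exists_crossing f τ x s).choose)
    (sub_nonneg.mpr (exists_crossing f τ x s).choose_spec.1)
    (by have := (exists_crossing f τ x s).choose_spec.2
        rw [crossing_succ] at this
        linarith)

theorem wrap_eq {X : Type*} [TopologicalSpace X] [CompactSpace X] (f : X ≃ₜ X)
    (τ : C(X, Set.Ioi (0 : ℝ))) (x : X) (s : ℝ) (n : ℤ)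
    (y : X) (r : ℝ) (hy : y = (f ^ n) x) (hr : r = s - crossing f τ x n) (h0 : 0 ≤ r)
    (h1 : r < τ y) : wrap f τ x s = mk f τ y r h0 h1.le := by
  have hn : (exists_crossing f τ x s).choose = n := by
    refine sumSeq_unique (fun j => (τ ((f ^ j) x)).2) (exists_crossing f τ x s).choose_spec.1
      (exists_crossing f τ x s).choose_spec.2 (sub_nonneg.mp (hr ▸ h0)) ?_
    have := crossing_succ f τ x n
    unfold crossing at this hr
    rw [this]
    subst hy
    linarith
  unfold wrap
  simp only [hn]
  subst hy hr
  rfl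

theorem mk_roof {X : Type*} [TopologicalSpace X] (f : X ≃ₜ X) (τ : C(X, Set.Ioi (0 : ℝ)))
    (x : X) (h0 : (0 : ℝ) ≤ τ x) (h1 : (0 : ℝ) ≤ τ (f x)) :
    mk f τ x (τ x) h0 le_rfl = mk f τ (f x) 0 le_rfl h1 :=
  Quot.sound ⟨rfl, rfl, rfl⟩

theorem wrap_of_mem {X : Type*} [TopologicalSpace X] [CompactSpace X] (f : X ≃ₜ X)
    (τ : C(X, Set.Ioi (0 : ℝ))) (x : X) (s : ℝ) (h0 : 0 ≤ s) (h1 : s ≤ τ x) :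
    wrap f τ x s = mk f τ x s h0 h1 := by
  rcases h1.lt_or_eq with h | h
  · exact wrap_eq f τ x s 0 x s (by simp) (by simp [crossing, sumSeq_zero]) h0 h
  · subst h
    rw [mk_roof f τ x h0 (le_of_lt (τ (f x)).2)]
    refine wrap_eq f τ x _ 1 (f x) 0 (by simp) ?_ le_rfl (τ (f x)).2
    have := crossing_succ f τ x 0
    simp only [zero_add, zpow_zero, Homeomorph.one_apply] at this
    rw [this]
    simp [crossing, sumSeq_zero]

theorem wrap_shift {X : Type*} [TopologicalSpace X] [CompactSpace X] (f : X ≃ₜ X)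
    (τ : C(X, Set.Ioi (0 : ℝ))) (x : X) (s : ℝ) :
    wrap f τ x (τ x + s) = wrap f τ (f x) s := by
  obtain ⟨n, hn, hn'⟩ := exists_crossing f τ (f x) s
  have step : (f ^ n) (f x) = (f ^ (n + 1)) x := by
    rw [zpow_add_one]; rfl
  rw [crossing_succ] at hn'
  rw [wrap_eq f τ (f x) s n _ _ rfl rfl (by linarith) (by linarith)]
  exact wrap_eq f τ x _ (n + 1) _ _ step (by rw [crossing_shift]; ring) (by linarith) (by linarith)

theorem wrap_zpow {X : Type*} [TopologicalSpace X] [CompactSpace X] (f : X ≃ₜ X)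
    (τ : C(X, Set.Ioi (0 : ℝ))) (x : X) (n : ℤ) :
    ∀ s : ℝ, wrap f τ ((f ^ n) x) s = wrap f τ x (crossing f τ x n + s) := by
  have step : ∀ m : ℤ, (f ^ (m + 1)) x = f ((f ^ m) x) := fun m => by
    rw [add_comm, zpow_one_add]; rfl
  induction n using Int.induction_on with
  | zero => intro s; simp [crossing, sumSeq_zero]
  | succ i ih =>
    intro s
    rw [step, ← wrap_shift, ih, crossing_succ, add_assoc]
  | pred i ih =>
    intro s
    have h1 := step (-(i : ℤ) - 1)
    have h2 := crossing_succ f τ x (-(i : ℤ) - 1)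
    rw [sub_add_cancel] at h1 h2
    have h3 := wrap_shift f τ ((f ^ (-(i : ℤ) - 1)) x) (s - τ ((f ^ (-(i : ℤ) - 1)) x))
    rw [← h1, ih, h2] at h3
    convert h3 using 2 <;> ring

/-- The time `t` map of the suspension flow; it moves `(x, s)` to `(x, s + t)` and continues
through the identification `(x, τ x) ∼ (f x, 0)`. -/
noncomputable def flowMap {X : Type*} [TopologicalSpace X] [CompactSpace X] (f : X ≃ₜ X)
    (τ : C(X, Set.Ioi (0 : ℝ))) (t : ℝ) : Suspension f τ → Suspension f τ :=
  Quot.lift (fun q => wrap f τ q.1.1 (q.1.2 + t)) fun q q' h => by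
    obtain ⟨h1, h2, h3⟩ := h
    simp only [h1, h2, h3, zero_add, wrap_shift]

theorem flowMap_wrap {X : Type*} [TopologicalSpace X] [CompactSpace X] (f : X ≃ₜ X)
    (τ : C(X, Set.Ioi (0 : ℝ))) (x : X) (s t : ℝ) :
    flowMap f τ t (wrap f τ x s) = wrap f τ x (s + t) := by
  obtain ⟨n, hn, hn'⟩ := exists_crossing f τ x s
  rw [crossing_succ] at hn'
  rw [wrap_eq f τ x s n _ _ rfl rfl (by linarith) (by linarith)]
  change wrap f τ ((f ^ n) x) (s - crossing f τ x n + t) = _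
  rw [wrap_zpow]
  congr 1
  ring

/-- The suspension flow `φ^{τ,f}` over `f` with height function `τ`. -/
noncomputable def flow {X : Type*} [TopologicalSpace X] [CompactSpace X] (f : X ≃ₜ X)
    (τ : C(X, Set.Ioi (0 : ℝ))) : RealFlow (Suspension f τ) where
  toFun := flowMap f τ
  map_zero := by
    rintro ⟨q⟩
    change wrap f τ q.1.1 (q.1.2 + 0) = _
    rw [add_zero, wrap_of_mem f τ _ _ q.2.1 q.2.2]
    rfl
  map_add := by
    rintro s t ⟨q⟩
    change flowMap f τ t (wrap f τ q.1.1 (q.1.2 + s)) = wrap f τ q.1.1 (q.1.2 + (s + t))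
    rw [flowMap_wrap, add_assoc]

/-- The formula that determines the suspension flow. -/
theorem flow_mk {X : Type*} [TopologicalSpace X] [CompactSpace X] (f : X ≃ₜ X)
    (τ : C(X, Set.Ioi (0 : ℝ))) (x : X) (s t : ℝ) (h0 : 0 ≤ s) (h1 : s ≤ τ x)
    (h2 : 0 ≤ s + t) (h3 : s + t ≤ τ x) :
    (flow f τ).toFun t (mk f τ x s h0 h1) = mk f τ x (s + t) h2 h3 :=
  wrap_of_mem f τ x (s + t) h2 h3

/-! #### The Bowen–Walters metric -/

/-- `IsChain f τ p q c`: there is a finite chain of segments from `p` to `q` of total length `c`.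
A horizontal segment joins `(x, u τ(x))` and `(y, u τ(y))` and has length
`(1 - u) d(x, y) + u d(f x, f y)`; a vertical segment joins `(x, u τ(x))` and `(x, v τ(x))` and
has length `|u - v|`. For `τ = 1` these are the segments of Bowen and Walters (a longer piece of
orbit is a concatenation of vertical segments); for the other roof functions they are the images
of those under the homeomorphism `(x, u) ↦ (x, u τ(x))`. -/
inductive IsChain {X : Type*} [MetricSpace X] (f : X ≃ₜ X) (τ : C(X, Set.Ioi (0 : ℝ))) :
    Suspension f τ → Suspension f τ → ℝ → Prop
  | refl (p : Suspension f τ) : IsChain f τ p p 0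
  | horizontal (x y : X) (u : Set.Icc (0 : ℝ) 1) (q : Suspension f τ) (c : ℝ) :
      IsChain f τ (atHeight f τ y u) q c →
      IsChain f τ (atHeight f τ x u) q
        ((1 - (u : ℝ)) * dist x y + (u : ℝ) * dist (f x) (f y) + c)
  | vertical (x : X) (u v : Set.Icc (0 : ℝ) 1) (q : Suspension f τ) (c : ℝ) :
      IsChain f τ (atHeight f τ x v) q c →
      IsChain f τ (atHeight f τ x u) q (|(u : ℝ) - v| + c)

theorem IsChain.nonneg {X : Type*} [MetricSpace X] {f : X ≃ₜ X} {τ : C(X, Set.Ioi (0 : ℝ))}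
    {p q : Suspension f τ} {c : ℝ} (h : IsChain f τ p q c) : 0 ≤ c := by
  induction h with
  | refl p => exact le_rfl
  | horizontal x y u q c _ ih =>
    have h0 := u.2.1
    have h1 : 0 ≤ 1 - (u : ℝ) := sub_nonneg.mpr u.2.2
    positivity
  | vertical x u v q c _ ih => positivity

theorem exists_atHeight {X : Type*} [TopologicalSpace X] {f : X ≃ₜ X}
    {τ : C(X, Set.Ioi (0 : ℝ))} (p : Suspension f τ) : ∃ x u, p = atHeight f τ x u := by
  obtain ⟨⟨⟨x, s⟩, h0, h1⟩⟩ := p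
  have hpos : (0 : ℝ) < τ x := (τ x).2
  refine ⟨x, ⟨s / τ x, div_nonneg h0 hpos.le, (div_le_one hpos).mpr h1⟩, ?_⟩
  unfold atHeight mk
  congr 3
  exact (div_mul_cancel₀ s hpos.ne').symm

/-- Any two points of the suspension are joined by a chain. -/
theorem exists_isChain {X : Type*} [MetricSpace X] {f : X ≃ₜ X} {τ : C(X, Set.Ioi (0 : ℝ))}
    (p q : Suspension f τ) : ∃ c, IsChain f τ p q c := by
  obtain ⟨x, u, rfl⟩ := exists_atHeight p
  obtain ⟨y, v, rfl⟩ := exists_atHeight q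
  exact ⟨_, .vertical x u v _ _ (.horizontal x y v _ _ (.refl _))⟩

/-- The Bowen–Walters distance `d^{τ,f}`: the infimum of the lengths of the chains. -/
noncomputable instance instDist {X : Type*} [MetricSpace X] (f : X ≃ₜ X)
    (τ : C(X, Set.Ioi (0 : ℝ))) : Dist (Suspension f τ) :=
  ⟨fun p q => sInf {c : ℝ | IsChain f τ p q c}⟩

end Suspension

end Suspension

/-! Measure height so that one passage from floor to roof counts `1`, and unroll the suspension to
`X × ℝ` by `cover`, where `(f^n x, w)` and `(x, w + n)` have the same image. There the flow fixes
the base coordinate and only raises the height, at a rate bounded above and below by compactness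
(`heightTime_sub_bounds`). A short chain starting at height near `m` lifts to a small change of
height and a small change of the base point after `f^m` (`IsChain.exists_lift`,
`exists_cover_of_dist_lt`); conversely, closeness after two consecutive iterates bounds the
Bowen–Walters distance (`dist_cover_le`).

From `f` to the flow: lift a pseudo-orbit to points `(a i, w i)` of the cover with small jumps
(`exists_lifted_pseudoOrbit`). Reading `f^n (a i)` when the height passes `n + w₀` gives a
pseudo-orbit of `f`. If `q` shadows it, the orbit over `q` shadows the flow pseudo-orbit, after a
reparametrization that absorbs the height jumps.

From the flow to `f`: cut a pseudo-orbit of `f` into blocks of `k` steps, long enough for the flow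
to spend time at least `1` in each, and suspend it. The height of a shadowing orbit differs from
that of the pseudo-orbit by nearly an integer; by continuity this integer `N` never changes
(`exists_int_near`), and `f^(-N) q` shadows the original sequence. -/

/-! ### Bi-infinite sequences and increasing bijections of the line -/

theorem sumSeq_sub (w : ℤ → ℝ) (i : ℤ) :
    sumSeq (fun j => w (j + 1) - w j) i = w i - w 0 := by
  induction i using Int.induction_on with
  | zero => simp [sumSeq_zero]
  | succ i ih => rw [sumSeq_succ, ih]; ring
  | pred i ih =>
    have h := sumSeq_succ (fun j => w (j + 1) - w j) (-(i : ℤ) - 1)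
    rw [sub_add_cancel] at h
    linarith

theorem exists_le_lt_succ {w : ℤ → ℝ} {c : ℝ} (hc : 0 < c) (hw : ∀ i, w i + c ≤ w (i + 1))
    (v : ℝ) : ∃ i, w i ≤ v ∧ v < w (i + 1) := by
  obtain ⟨i, h1, h2⟩ := sumSeq_exists (t := fun j => w (j + 1) - w j) hc
    (fun j => by linarith [hw j]) (v - w 0)
  rw [sumSeq_sub] at h1 h2
  exact ⟨i, by linarith, by linarith⟩

theorem strictMono_of_step {w : ℤ → ℝ} {c : ℝ} (hc : 0 < c) (hw : ∀ i, w i + c ≤ w (i + 1)) :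
    StrictMono w :=
  strictMono_int_of_lt_succ fun i => by linarith [hw i]

theorem mul_le_sub_of_step {w : ℤ → ℝ} {c : ℝ} (hw : ∀ i, w i + c ≤ w (i + 1)) {i j : ℤ}
    (hij : i ≤ j) : (j - i : ℝ) * c ≤ w j - w i := by
  induction j, hij using Int.leInduction with
  | base => simp
  | succ j _ ih => push_cast; linarith [hw j]

/-- Increasing bijections of the line that match along two bi-infinite sequences can be glued. -/
theorem exists_glue {s w : ℤ → ℝ} {c c' : ℝ} (hc : 0 < c) (hs : ∀ i, s i + c ≤ s (i + 1))
    (hc' : 0 < c') (hw : ∀ i, w i + c' ≤ w (i + 1)) (G : ℤ → ℝ → ℝ) (hG : ∀ i, StrictMono (G i))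
    (hGs : ∀ i, Function.Surjective (G i)) (h0 : ∀ i, G i (s i) = w i)
    (h1 : ∀ i, G i (s (i + 1)) = w (i + 1)) :
    ∃ H : ℝ → ℝ, StrictMono H ∧ Function.Surjective H ∧
      ∀ i r, s i ≤ r → r ≤ s (i + 1) → H r = G i r := by
  have smono := strictMono_of_step hc hs
  have wmono := strictMono_of_step hc' hw
  choose I hI hI' using exists_le_lt_succ hc hs
  have key : ∀ i r, s i ≤ r → r < s (i + 1) → I r = i := fun i r h h' => by
    have h3 := smono.lt_iff_lt.mp ((hI r).trans_lt h')
    have h4 := smono.lt_iff_lt.mp (h.trans_lt (hI' r))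
    lia
  refine ⟨fun r => G (I r) r, fun r r' hr => ?_, fun v => ?_, fun i r h h' => ?_⟩
  · rcases lt_trichotomy (I r) (I r') with h | h | h
    · calc G (I r) r < G (I r) (s (I r + 1)) := hG _ (hI' r)
        _ = w (I r + 1) := h1 _
        _ ≤ w (I r') := wmono.monotone h
        _ = G (I r') (s (I r')) := (h0 _).symm
        _ ≤ G (I r') r' := (hG _).monotone (hI r')
    · simp only [h]
      exact hG _ hr
    · have := (hI' r').trans_le ((smono.monotone (show I r' + 1 ≤ I r from h)).trans (hI r))
      linarith
  · obtain ⟨i, hi, hi'⟩ := exists_le_lt_succ hc' hw v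
    obtain ⟨r, rfl⟩ := hGs i v
    rw [← h0, (hG i).le_iff_le] at hi
    rw [← h1, (hG i).lt_iff_lt] at hi'
    exact ⟨r, by simp only [key i r hi hi']⟩
  · rcases h'.lt_or_eq with h' | rfl
    · simp only [key i r h h']
    · have : I (s (i + 1)) = i + 1 := key _ _ le_rfl (smono (lt_add_one _))
      simp only [this, h0, h1]

theorem strictMono_surjective_continuous {h : ℝ → ℝ} (h1 : StrictMono h)
    (h2 : Function.Surjective h) : Continuous h :=
  h1.monotone.continuous_of_surjective h2

/-- A continuous function that stays near the integers stays near one of them. -/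
theorem exists_int_near {g : ℝ → ℝ} (hg : Continuous g) {e : ℝ} (he : e < 1 / 2)
    (h : ∀ r, ∃ n : ℤ, |g r - n| ≤ e) : ∃ n : ℤ, ∀ r, |g r - n| ≤ e := by
  obtain ⟨n, hn⟩ := h 0
  refine ⟨n, fun r => ?_⟩
  obtain ⟨m, hm⟩ := h r
  -- The range is an interval that misses every half-integer, so it cannot contain values near two
  -- different integers.
  have avoid : ∀ k : ℤ, (k : ℝ) + 1 / 2 ∉ Set.range g := by
    rintro k ⟨r', hr'⟩
    obtain ⟨l, hl⟩ := h r'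
    rw [hr', abs_le] at hl
    rcases le_or_gt l k with hlk | hlk
    · have : (l : ℝ) ≤ k := by exact_mod_cast hlk
      linarith
    · have : (k : ℝ) + 1 ≤ l := by exact_mod_cast hlk
      linarith
  have hconn : (Set.range g).OrdConnected := (isPreconnected_range hg).ordConnected
  have h0 := Set.mem_range_self (f := g) 0
  have hr := Set.mem_range_self (f := g) r
  rcases lt_trichotomy n m with hnm | rfl | hnm
  · have : (n : ℝ) + 1 ≤ m := by exact_mod_cast hnm
    rw [abs_le] at hn hm
    exact absurd (hconn.out h0 hr ⟨by linarith, by linarith⟩) (avoid n)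
  · exact hm
  · have : (m : ℝ) + 1 ≤ n := by exact_mod_cast hnm
    rw [abs_le] at hn hm
    exact absurd (hconn.out hr h0 ⟨by linarith, by linarith⟩) (avoid m)

/-- Bi-infinite dependent choice. -/
theorem exists_int_seq {α : Type*} (S : ℤ → α → Prop) (R : ℤ → α → α → Prop)
    (fwd : ∀ i a, S i a → ∃ b, S (i + 1) b ∧ R i a b)
    (bwd : ∀ i b, S (i + 1) b → ∃ a, S i a ∧ R i a b) (a₀ : α) (h₀ : S 0 a₀) :
    ∃ a : ℤ → α, a 0 = a₀ ∧ (∀ i, S i (a i)) ∧ ∀ i, R i (a i) (a (i + 1)) := by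
  choose! F hF hF' using fwd
  choose! B hB hB' using bwd
  -- `F` steps forward from `a₀` and `B` backward; the shift by `2` appears because `Int.negSucc (k
  -- + 1)` is `-k - 2`.
  let a : ℤ → α := fun i => Int.rec (fun n => Nat.rec a₀ (fun k b => F k b) n)
    (fun n => Nat.rec (B (-1) a₀) (fun k b => B (-(k : ℤ) - 2) b) n) i
  have a1 : ∀ n : ℕ, a (n + 1 : ℕ) = F n (a n) := fun n => rfl
  have b0 : a (-1) = B (-1) a₀ := rfl
  have b1 : ∀ n : ℕ, a (Int.negSucc (n + 1)) = B (-(n : ℤ) - 2) (a (Int.negSucc n)) := fun n => rfl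
  have hS : ∀ i, S i (a i) := by
    intro i
    cases i with
    | ofNat n =>
      induction n with
      | zero => exact h₀
      | succ k ih => exact hF k _ ih
    | negSucc n =>
      induction n with
      | zero => exact hB (-1) _ (by simpa using h₀)
      | succ k ih =>
        rw [b1]
        have e : Int.negSucc (k + 1) = -(k : ℤ) - 2 := by rw [Int.negSucc_eq]; push_cast; ring
        have e' : Int.negSucc k = -(k : ℤ) - 2 + 1 := by rw [Int.negSucc_eq]; ring
        rw [e]
        exact hB _ _ (e' ▸ ih)
  refine ⟨a, rfl, hS, fun i => ?_⟩
  cases i with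
  | ofNat n => exact hF' n _ (hS n)
  | negSucc n =>
    cases n with
    | zero => exact hB' (-1) _ (by simpa using h₀)
    | succ k =>
      have e : Int.negSucc (k + 1) = -(k : ℤ) - 2 := by rw [Int.negSucc_eq]; push_cast; ring
      have e' : -(k : ℤ) - 2 + 1 = Int.negSucc k := by rw [Int.negSucc_eq]; ring
      have hb := b1 k
      rw [e] at hb ⊢
      rw [hb, e']
      exact hB' (-(k : ℤ) - 2) _ (e' ▸ hS _)

/-! ### Uniform continuity of iterates and bounds for the roof -/

section Modulus

variable {X : Type*} [MetricSpace X] [CompactSpace X]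

theorem exists_modulus (f : X ≃ₜ X) (K : ℕ) {η : ℝ} (hη : 0 < η) :
    ∃ δ > 0, ∀ a b : X, dist a b ≤ δ → ∀ j : ℤ, |j| ≤ K → dist ((f ^ j) a) ((f ^ j) b) ≤ η := by
  have h : ∀ᶠ p in uniformity X, ∀ j ∈ Finset.Icc (-(K : ℤ)) K,
      dist ((f ^ j) p.1) ((f ^ j) p.2) < η := by
    rw [Filter.eventually_all_finset]
    intro j _
    exact CompactSpace.uniformContinuous_of_continuous (f ^ j).continuous
      (Metric.dist_mem_uniformity hη)
  obtain ⟨δ, hδ, h⟩ := Metric.mem_uniformity_dist.mp h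
  refine ⟨δ / 2, half_pos hδ, fun a b hab j hj => (h (a := a) (b := b) (by linarith) j ?_).le⟩
  rw [abs_le] at hj
  exact Finset.mem_Icc.mpr hj

/-- Errors accumulate over only `K` steps: by uniform continuity of `f`, each further step carries
the earlier error to at most `η / 2` and adds one new jump. -/
theorem exists_pseudoOrbit_modulus (f : X ≃ₜ X) (K : ℕ) {η : ℝ} (hη : 0 < η) :
    ∃ δ > 0, ∀ z : ℤ → X, IsPseudoOrbit f δ z → ∀ (n : ℤ) (j : ℕ), j ≤ K →
      dist ((f ^ (j : ℤ)) (z n)) (z (n + j)) ≤ η := by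
  induction K generalizing η with
  | zero =>
    refine ⟨1, one_pos, fun z _ n j hj => ?_⟩
    obtain rfl : j = 0 := by lia
    simpa using hη.le
  | succ K ih =>
    obtain ⟨δ₁, h₁, H₁⟩ := exists_modulus f 1 (half_pos hη)
    obtain ⟨δ₂, h₂, H₂⟩ := ih (η := min δ₁ η) (by positivity)
    refine ⟨min δ₂ (η / 2), by positivity, fun z hz n j hj => ?_⟩
    have H := H₂ z (fun n => (hz n).trans (min_le_left _ _)) n
    rcases Nat.lt_or_ge K j with hj' | hj'
    · obtain rfl : j = K + 1 := by lia
      have e1 := H₁ _ _ ((H K le_rfl).trans (min_le_left _ _)) 1 (by simp)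
      have e2 := (hz (n + K)).trans (min_le_right _ _)
      have e3 : (f ^ ((K + 1 : ℕ) : ℤ)) (z n) = f ((f ^ (K : ℤ)) (z n)) := by
        push_cast; rw [add_comm, zpow_one_add]; rfl
      rw [e3]
      rw [zpow_one] at e1
      push_cast
      rw [← add_assoc]
      linarith [dist_triangle (f ((f ^ (K : ℤ)) (z n))) (f (z (n + K))) (z (n + K + 1))]
    · exact (H j hj').trans (min_le_right _ _)

theorem exists_roof_bounds (τ : C(X, Set.Ioi (0 : ℝ))) :
    ∃ c M : ℝ, 0 < c ∧ 0 < M ∧ ∀ x, c ≤ (τ x : ℝ) ∧ (τ x : ℝ) ≤ M := by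
  rcases isEmpty_or_nonempty X with hX | hX
  · exact ⟨1, 1, one_pos, one_pos, fun x => hX.elim x⟩
  have hc : ContinuousOn (fun y => (τ y : ℝ)) Set.univ :=
    (continuous_subtype_val.comp τ.continuous).continuousOn
  obtain ⟨z, -, hz⟩ := isCompact_univ.exists_isMinOn Set.univ_nonempty hc
  obtain ⟨y, -, hy⟩ := isCompact_univ.exists_isMaxOn Set.univ_nonempty hc
  exact ⟨τ z, τ y, (τ z).2, (τ y).2, fun x => ⟨hz (Set.mem_univ x), hy (Set.mem_univ x)⟩⟩

end Modulus

/-! ### Normalized height along an orbit -/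

namespace Suspension

variable {X : Type*} [MetricSpace X]

/-- The time at which the orbit of `(x, 0)` reaches the normalized height `w`, where the height
increases by `1` along each passage from the floor to the roof. -/
noncomputable def heightTime (f : X ≃ₜ X) (τ : C(X, Set.Ioi (0 : ℝ))) (x : X) (w : ℝ) : ℝ :=
  crossing f τ x ⌊w⌋ + Int.fract w * τ ((f ^ ⌊w⌋) x)

section HeightTime

variable {f : X ≃ₜ X} {τ : C(X, Set.Ioi (0 : ℝ))}

theorem heightTime_add (x : X) (n : ℤ) {u : ℝ} (h0 : 0 ≤ u) (h1 : u ≤ 1) :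
    heightTime f τ x (n + u) = crossing f τ x n + u * τ ((f ^ n) x) := by
  rcases h1.lt_or_eq with h | rfl
  · have hf : ⌊(n : ℝ) + u⌋ = n := by
      rw [Int.floor_eq_iff]
      exact ⟨by linarith, by linarith⟩
    unfold heightTime
    rw [Int.fract, hf]
    ring
  · have hf : ⌊(n : ℝ) + 1⌋ = n + 1 := by simp
    unfold heightTime
    rw [Int.fract, hf, crossing_succ]
    push_cast
    ring

theorem crossing_sub_bounds {c M : ℝ} (hb : ∀ x, c ≤ (τ x : ℝ) ∧ (τ x : ℝ) ≤ M) (x : X)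
    {n m : ℤ} (h : n ≤ m) : (m - n : ℝ) * c ≤ crossing f τ x m - crossing f τ x n ∧
      crossing f τ x m - crossing f τ x n ≤ (m - n : ℝ) * M := by
  induction m, h using Int.leInduction with
  | base => simp
  | succ m _ ih =>
    rw [crossing_succ]
    push_cast
    have := hb ((f ^ m) x)
    constructor <;> linarith [ih.1, ih.2]

/-- Time is piecewise linear in height, with slopes the values of the roof function along the orbit.
This converts lower bounds on flight times into lower bounds on height gains, and back. -/
theorem heightTime_sub_bounds {c M : ℝ}
    (hb : ∀ x, c ≤ (τ x : ℝ) ∧ (τ x : ℝ) ≤ M) (x : X) {w v : ℝ} (h : w ≤ v) :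
    (v - w) * c ≤ heightTime f τ x v - heightTime f τ x w ∧
      heightTime f τ x v - heightTime f τ x w ≤ (v - w) * M := by
  have hw := Int.floor_add_fract w
  have hv := Int.floor_add_fract v
  have hw0 := Int.fract_nonneg w
  have hw1 := (Int.fract_lt_one w).le
  have hv0 := Int.fract_nonneg v
  have bw := hb ((f ^ ⌊w⌋) x)
  have bv := hb ((f ^ ⌊v⌋) x)
  unfold heightTime
  rcases (Int.floor_le_floor h).eq_or_lt with e | e
  · have e' : (⌊w⌋ : ℝ) = ⌊v⌋ := by rw [e]
    rw [← e] at bv ⊢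
    have e2 : Int.fract v - Int.fract w = v - w := by linarith
    have e3 : 0 ≤ v - w := by linarith
    have a1 := mul_le_mul_of_nonneg_left bw.1 e3
    have a2 := mul_le_mul_of_nonneg_left bw.2 e3
    rw [← e2] at a1 a2 ⊢
    constructor <;> linarith
  · have hcr := crossing_sub_bounds (f := f) hb x (show ⌊w⌋ + 1 ≤ ⌊v⌋ from e)
    rw [crossing_succ] at hcr
    push_cast at hcr
    have e2 : v - w = (⌊v⌋ - (⌊w⌋ + 1) : ℝ) + (1 - Int.fract w) + Int.fract v := by linarith
    have a1 := mul_le_mul_of_nonneg_left bw.1 (sub_nonneg.mpr hw1)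
    have a2 := mul_le_mul_of_nonneg_left bw.2 (sub_nonneg.mpr hw1)
    have a3 := mul_le_mul_of_nonneg_left bv.1 hv0
    have a4 := mul_le_mul_of_nonneg_left bv.2 hv0
    rw [e2]
    constructor <;> linarith

theorem heightTime_strictMono [CompactSpace X] (x : X) : StrictMono (heightTime f τ x) := by
  obtain ⟨c, M, hc, -, hb⟩ := exists_roof_bounds τ
  intro w v h
  have := (heightTime_sub_bounds (f := f) hb x h.le).1
  nlinarith [mul_pos (sub_pos.mpr h) hc]

theorem heightTime_surjective [CompactSpace X] (x : X) :
    Function.Surjective (heightTime f τ x) := by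
  intro s
  obtain ⟨n, h1, h2⟩ := exists_crossing f τ x s
  rw [crossing_succ] at h2
  have hpos : (0 : ℝ) < τ ((f ^ n) x) := (τ ((f ^ n) x)).2
  refine ⟨n + (s - crossing f τ x n) / τ ((f ^ n) x), ?_⟩
  rw [heightTime_add x n (div_nonneg (by linarith) hpos.le)
    ((div_le_one hpos).mpr (by linarith)), div_mul_cancel₀ _ hpos.ne']
  ring

end HeightTime

theorem zpow_zpow_neg (f : X ≃ₜ X) (n : ℤ) (x : X) : (f ^ n) ((f ^ (-n)) x) = x := by
  rw [← Homeomorph.mul_apply, ← zpow_add]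
  simp

/-! ### Chains and the Bowen–Walters distance -/

section Chains

variable {f : X ≃ₜ X} {τ : C(X, Set.Ioi (0 : ℝ))}

theorem IsChain.trans {p q r : Suspension f τ} {b c : ℝ} (h : IsChain f τ p q b)
    (h' : IsChain f τ q r c) : IsChain f τ p r (b + c) := by
  induction h with
  | refl p => simpa using h'
  | horizontal x y u q b _ ih =>
    rw [add_assoc]
    exact .horizontal x y u _ _ (ih h')
  | vertical x u v q b _ ih =>
    rw [add_assoc]
    exact .vertical x u v _ _ (ih h')

theorem IsChain.symm {p q : Suspension f τ} {c : ℝ} (h : IsChain f τ p q c) :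
    IsChain f τ q p c := by
  induction h with
  | refl p => exact .refl p
  | horizontal x y u q b _ ih =>
    have := ih.trans (.horizontal y x u _ _ (.refl _))
    rwa [add_zero, dist_comm y x, dist_comm (f y), add_comm] at this
  | vertical x u v q b _ ih =>
    have := ih.trans (.vertical x v u _ _ (.refl _))
    rwa [add_zero, abs_sub_comm (v : ℝ), add_comm] at this

theorem dist_symm (p q : Suspension f τ) : dist p q = dist q p := by
  change sInf {c : ℝ | IsChain f τ p q c} = sInf {c : ℝ | IsChain f τ q p c}
  congr 1
  exact Set.ext fun c => ⟨IsChain.symm, IsChain.symm⟩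

theorem dist_le_of_isChain {p q : Suspension f τ} {c : ℝ} (h : IsChain f τ p q c) :
    dist p q ≤ c :=
  csInf_le ⟨0, fun _ hb => IsChain.nonneg hb⟩ h

end Chains

/-! ### The covering by `X × ℝ` and its metric -/

variable [CompactSpace X] {f : X ≃ₜ X} {τ : C(X, Set.Ioi (0 : ℝ))}

/-- The increasing bijection between heights and times along the orbit of `(x, 0)`. -/
noncomputable def heightIso (f : X ≃ₜ X) (τ : C(X, Set.Ioi (0 : ℝ))) (x : X) : ℝ ≃o ℝ :=
  (heightTime_strictMono (f := f) (τ := τ) x).orderIsoOfSurjective _ (heightTime_surjective x)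

theorem heightIso_sub_bounds {c M : ℝ}
    (hb : ∀ x, c ≤ (τ x : ℝ) ∧ (τ x : ℝ) ≤ M) (x : X) {w v : ℝ} (h : w ≤ v) :
    (v - w) * c ≤ heightIso f τ x v - heightIso f τ x w ∧
      heightIso f τ x v - heightIso f τ x w ≤ (v - w) * M :=
  heightTime_sub_bounds hb x h

/-- The point of height `w` on the orbit of `(x, 0)`; this is the covering map from `X × ℝ` onto
the suspension. -/
noncomputable def cover (f : X ≃ₜ X) (τ : C(X, Set.Ioi (0 : ℝ))) (x : X) (w : ℝ) :
    Suspension f τ :=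
  wrap f τ x (heightIso f τ x w)

theorem cover_add (x : X) (n : ℤ) (u : Set.Icc (0 : ℝ) 1) :
    cover f τ x (n + u) = atHeight f τ ((f ^ n) x) u := by
  unfold cover
  have h : heightIso f τ x (n + u) = crossing f τ x n + u * τ ((f ^ n) x) :=
    heightTime_add x n u.2.1 u.2.2
  rw [h, ← wrap_zpow]
  exact wrap_of_mem f τ _ _ _ _

theorem cover_eq_atHeight (x : X) (w : ℝ) : ∃ (n : ℤ) (u : Set.Icc (0 : ℝ) 1),
    w = n + u ∧ (u : ℝ) < 1 ∧ cover f τ x w = atHeight f τ ((f ^ n) x) u := by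
  refine ⟨⌊w⌋, ⟨Int.fract w, Int.fract_nonneg w, (Int.fract_lt_one w).le⟩,
    (Int.floor_add_fract w).symm, Int.fract_lt_one w, ?_⟩
  rw [← cover_add]
  simp [Int.floor_add_fract]

theorem cover_of_mem (x : X) (u : Set.Icc (0 : ℝ) 1) :
    cover f τ x u = atHeight f τ x u := by
  simpa using cover_add (f := f) (τ := τ) x 0 u

theorem cover_zpow (x : X) (n : ℤ) (w : ℝ) :
    cover f τ ((f ^ n) x) w = cover f τ x (w + n) := by
  obtain ⟨m, u, hw, -, h⟩ := cover_eq_atHeight (f := f) (τ := τ) ((f ^ n) x) w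
  have e : w + n = ((m + n : ℤ) : ℝ) + u := by rw [hw]; push_cast; ring
  rw [h, e, cover_add, zpow_add]
  rfl

theorem flow_cover (x : X) (w t : ℝ) : (flow f τ).toFun t (cover f τ x w) =
    cover f τ x ((heightIso f τ x).symm (heightIso f τ x w + t)) := by
  unfold cover
  rw [OrderIso.apply_symm_apply]
  exact flowMap_wrap f τ x _ t

/-- The points of `X × ℝ` over a point of the suspension. -/
def fiber (f : X ≃ₜ X) (τ : C(X, Set.Ioi (0 : ℝ))) : Suspension f τ → Set (X × ℝ) :=
  Quot.lift (fun q => {p | ∃ n : ℤ, q.1.1 = (f ^ n) p.1 ∧ q.1.2 = (p.2 - n) * τ q.1.1})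
    fun q q' h => by
      obtain ⟨h1, h2, h3⟩ := h
      have hpos : (0 : ℝ) < τ q.1.1 := (τ q.1.1).2
      have hpos' : (0 : ℝ) < τ q'.1.1 := (τ q'.1.1).2
      have step : ∀ (n : ℤ) (x : X), (f ^ (n + 1)) x = f ((f ^ n) x) := fun n x => by
        rw [add_comm, zpow_one_add]; rfl
      ext ⟨x, w⟩
      -- Passing from the roof point to the floor point it is glued to replaces `n` by `n + 1`, so
      -- the set of lifts is the same.
      constructor
      · rintro ⟨n, e1, e2⟩
        refine ⟨n + 1, by rw [h2, e1, step], ?_⟩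
        rw [h1] at e2
        have : w - n = 1 := by
          apply mul_right_cancel₀ hpos.ne'
          linarith
        push_cast
        rw [h3, show w - (n + 1 : ℝ) = 0 by linarith, zero_mul]
      · rintro ⟨n, e1, e2⟩
        refine ⟨n - 1, f.injective ?_, ?_⟩
        · rw [← step, sub_add_cancel, ← h2, e1]
        · rw [h3] at e2
          have : w - n = 0 := by
            rcases mul_eq_zero.mp e2.symm with h | h
            · exact h
            · exact absurd h hpos'.ne'
          push_cast
          rw [h1, show w - (n - 1 : ℝ) = 1 by linarith, one_mul]

theorem exists_of_cover_eq_atHeight {x y : X} {w : ℝ} {u : Set.Icc (0 : ℝ) 1}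
    (h : cover f τ x w = atHeight f τ y u) : ∃ n : ℤ, y = (f ^ n) x ∧ w = n + u := by
  obtain ⟨m, v, hw, -, h'⟩ := cover_eq_atHeight (f := f) (τ := τ) x w
  have h1 : (x, w) ∈ fiber f τ (cover f τ x w) := by
    rw [h']
    exact ⟨m, rfl, by rw [hw]; ring⟩
  rw [h] at h1
  obtain ⟨n, e1, e2⟩ := h1
  have hpos : (0 : ℝ) < τ y := (τ y).2
  refine ⟨n, e1, ?_⟩
  have := mul_right_cancel₀ hpos.ne' e2
  simp only at this
  linarith

/-- The only identifications of the cover are the deck transformations; this rests on `fiber` being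
well defined on the quotient. -/
theorem exists_of_cover_eq {x y : X} {w v : ℝ} (h : cover f τ x w = cover f τ y v) :
    ∃ n : ℤ, y = (f ^ n) x ∧ w = v + n := by
  obtain ⟨m, u, hv, -, h'⟩ := cover_eq_atHeight (f := f) (τ := τ) y v
  obtain ⟨n, e1, e2⟩ := exists_of_cover_eq_atHeight (h.trans h')
  refine ⟨n - m, ?_, by push_cast; linarith⟩
  apply (f ^ m).injective
  rw [e1, sub_eq_neg_add, zpow_add, zpow_neg]
  change _ = (f ^ m) ((f ^ m)⁻¹ ((f ^ n) x))
  exact ((f ^ m).apply_symm_apply _).symm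

/-- Chains lift to the cover, and short chains between points over the middle of the cover control
the distance of the base points. -/
theorem IsChain.exists_lift {p q : Suspension f τ} {c : ℝ} (h : IsChain f τ p q c) :
    ∀ (x : X) (w : ℝ), cover f τ x w = p → |w| + c ≤ 3 / 4 →
      ∃ (y : X) (v : ℝ), cover f τ y v = q ∧ |v - w| ≤ c ∧ dist x y ≤ 4 * c := by
  induction h with
  | refl p => exact fun x w hp _ => ⟨x, w, hp, by simp, by simp⟩
  | horizontal x₀ y₀ u q c hc ih =>
    intro x w hp hw
    obtain ⟨n, rfl, hn⟩ := exists_of_cover_eq_atHeight hp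
    have u0 := u.2.1
    have u1 := u.2.2
    have hc0 := hc.nonneg
    have e1 : cover f τ ((f ^ (-n)) y₀) w = atHeight f τ y₀ u := by
      rw [hn, cover_add, zpow_zpow_neg]
    have hlen : dist x ((f ^ (-n)) y₀) ≤
        4 * ((1 - (u : ℝ)) * dist ((f ^ n) x) y₀ + u * dist (f ((f ^ n) x)) (f y₀)) := by
      have d0 : 0 ≤ dist ((f ^ n) x) y₀ := dist_nonneg
      have d1 : 0 ≤ dist (f ((f ^ n) x)) (f y₀) := dist_nonneg
      have p0 : 0 ≤ (1 - (u : ℝ)) * dist ((f ^ n) x) y₀ := mul_nonneg (by linarith) d0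
      have p1 : 0 ≤ (u : ℝ) * dist (f ((f ^ n) x)) (f y₀) := mul_nonneg u0 d1
      have hwn : |w| ≤ 3 / 4 := by linarith
      rw [abs_le] at hwn
      have n1 : n < 1 := by
        have : (n : ℝ) < 1 := by linarith
        exact_mod_cast this
      have n2 : -2 < n := by
        have : (-2 : ℝ) < n := by linarith
        exact_mod_cast this
      -- Heights in `[-3/4, 3/4]` meet only the two floors adjacent to height `0`. On either one,
      -- the term of the horizontal length that measures distance at height `0` has weight at least
      -- `1/4`; hence the factor `4`.
      obtain rfl | rfl : n = 0 ∨ n = -1 := by lia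
      · have : (1 : ℝ) / 4 ≤ 1 - u := by push_cast at hn; linarith
        have := mul_le_mul_of_nonneg_right this d0
        simp only [neg_zero, zpow_zero, Homeomorph.one_apply] at *
        linarith
      · have : (1 : ℝ) / 4 ≤ u := by push_cast at hn; linarith
        have := mul_le_mul_of_nonneg_right this d1
        have e3 : f ((f ^ (-1 : ℤ)) x) = x := by simp
        simp only [neg_neg, zpow_one]
        rw [e3] at this p1 ⊢
        linarith
    have hlen0 : (0 : ℝ) ≤ dist x ((f ^ (-n)) y₀) := dist_nonneg
    obtain ⟨y, v, hy, hv, hd⟩ := ih ((f ^ (-n)) y₀) w e1 (by linarith)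
    exact ⟨y, v, hy, by linarith, by linarith [dist_triangle x ((f ^ (-n)) y₀) y]⟩
  | vertical x₀ u u' q c hc ih =>
    intro x w hp hw
    obtain ⟨n, rfl, hn⟩ := exists_of_cover_eq_atHeight hp
    have a1 : |(n + u' : ℝ) - w| = |(u : ℝ) - u'| := by
      rw [hn, abs_sub_comm]; congr 1; ring
    have a2 : |(n + u' : ℝ)| ≤ |w| + |(u : ℝ) - u'| := by
      rw [← a1]
      have := abs_add_le w ((n + u' : ℝ) - w)
      rwa [add_sub_cancel] at this
    obtain ⟨y, v, hy, hv, hd⟩ := ih x (n + u') (cover_add x n u') (by linarith)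
    exact ⟨y, v, hy, by linarith [abs_sub_le v (n + u' : ℝ) w],
      by linarith [abs_nonneg ((u : ℝ) - u')]⟩

/-- The deck transformation by `m` brings the height into `[-1/2, 1/2]`, which leaves `1/4` of room
for a chain to lift. -/
theorem exists_cover_of_dist_lt {x : X} {w : ℝ} {q : Suspension f τ} {c : ℝ} {m : ℤ}
    (h : dist (cover f τ x w) q < c) (hw : |w - m| ≤ 1 / 2) (hc : c ≤ 1 / 4) :
    ∃ (y : X) (v : ℝ), cover f τ y v = q ∧ |v - w| ≤ c ∧ dist ((f ^ m) x) ((f ^ m) y) ≤ 4 * c := by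
  obtain ⟨b, hb, hbc⟩ := exists_lt_of_csInf_lt (exists_isChain (cover f τ x w) q) h
  obtain ⟨y, v, hy, hv, hd⟩ := IsChain.exists_lift hb ((f ^ m) x) (w - m)
    (by rw [cover_zpow, sub_add_cancel]) (by linarith)
  refine ⟨(f ^ (-m)) y, v + m, ?_, ?_, ?_⟩
  · rw [← cover_zpow, zpow_zpow_neg, hy]
  · rw [show v + m - w = v - (w - m) by ring]
    linarith
  · rw [zpow_zpow_neg]
    linarith

theorem isChain_cover (x : X) {w v : ℝ} (h : w ≤ v) (h1 : v ≤ w + 1) :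
    IsChain f τ (cover f τ x w) (cover f τ x v) (v - w) := by
  obtain ⟨n, u, hw, hu, e⟩ := cover_eq_atHeight (f := f) (τ := τ) x w
  have u0 := u.2.1
  rcases le_or_gt v (n + 1) with hv | hv
  · have e' := cover_add (f := f) (τ := τ) x n ⟨v - n, by linarith, by linarith⟩
    simp only [add_sub_cancel] at e'
    rw [e, e']
    convert IsChain.vertical _ _ _ _ _ (.refl _) using 1
    rw [abs_sub_comm, abs_of_nonneg] <;> simp only <;> linarith
  · have e1 := cover_add (f := f) (τ := τ) x n ⟨1, by simp⟩
    have e2 := cover_add (f := f) (τ := τ) x (n + 1) ⟨0, by simp⟩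
    have e' := cover_add (f := f) (τ := τ) x (n + 1)
      ⟨v - (n + 1), by linarith, by linarith⟩
    push_cast at e1 e2 e'
    rw [add_zero] at e2
    rw [add_sub_cancel] at e'
    rw [e, e']
    have c2 : IsChain f τ (cover f τ x (n + 1)) (cover f τ x v) (v - (n + 1)) := by
      rw [e2, e']
      convert IsChain.vertical _ _ _ _ _ (.refl _) using 1
      rw [abs_sub_comm, abs_of_nonneg] <;> simp only <;> linarith
    rw [e1, e'] at c2
    convert IsChain.vertical _ u _ _ _ c2 using 1
    rw [abs_sub_comm, abs_of_nonneg] <;> simp only <;> linarith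

/-- Move horizontally at height `w`, at the cost of a convex combination of the two distances, then
along the orbit of `y`. -/
theorem dist_cover_le {x y : X} {w v b : ℝ} (h : |w - v| ≤ 1)
    (h0 : dist ((f ^ ⌊w⌋) x) ((f ^ ⌊w⌋) y) ≤ b)
    (h1 : dist ((f ^ (⌊w⌋ + 1)) x) ((f ^ (⌊w⌋ + 1)) y) ≤ b) :
    dist (cover f τ x w) (cover f τ y v) ≤ b + |w - v| := by
  have c1 : IsChain f τ (cover f τ y w) (cover f τ y v) |w - v| := by
    rw [abs_le] at h
    rcases le_total w v with hwv | hwv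
    · rw [abs_sub_comm, abs_of_nonneg (by linarith)]
      exact isChain_cover y hwv (by linarith)
    · rw [abs_of_nonneg (by linarith)]
      exact (isChain_cover y hwv (by linarith)).symm
  let u : Set.Icc (0 : ℝ) 1 := ⟨Int.fract w, Int.fract_nonneg w, (Int.fract_lt_one w).le⟩
  have hu : (u : ℝ) = Int.fract w := rfl
  have e : ∀ z, cover f τ z w = atHeight f τ ((f ^ ⌊w⌋) z) u := fun z => by
    rw [← cover_add, hu, Int.floor_add_fract]
  rw [e] at c1 ⊢
  refine (dist_le_of_isChain (.horizontal _ _ u _ _ c1)).trans ?_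
  have step : ∀ z : X, (f ^ (⌊w⌋ + 1)) z = f ((f ^ ⌊w⌋) z) := fun z => by
    rw [add_comm, zpow_one_add]; rfl
  rw [step, step] at h1
  have a0 := mul_le_mul_of_nonneg_left h0 (sub_nonneg.mpr u.2.2)
  have a1 := mul_le_mul_of_nonneg_left h1 u.2.1
  linarith

theorem exists_eq_cover (p : Suspension f τ) :
    ∃ (x : X) (u : Set.Icc (0 : ℝ) 1), p = atHeight f τ x u ∧ p = cover f τ x u := by
  obtain ⟨x, u, rfl⟩ := exists_atHeight p
  exact ⟨x, u, rfl, (cover_of_mem x u).symm⟩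

end Suspension

/-! ### Lifting pseudo-orbits of the flow -/

namespace Suspension

/-- Heights grow by at least `κ` per index, so at most `4 / κ + 1` jumps occur within `2` of height
`n`. -/
theorem dist_zpow_le_of_jumps {X : Type*} [MetricSpace X] {f : X ≃ₜ X} {w : ℤ → ℝ} {a : ℤ → X} {κ θ : ℝ} (hκ : 0 < κ) (hθ : 0 ≤ θ)
    (hw : ∀ i, w i + κ ≤ w (i + 1)) {n : ℤ}
    (hj : ∀ k, n - 2 ≤ w (k + 1) → w (k + 1) ≤ n + 2 →
      dist ((f ^ n) (a k)) ((f ^ n) (a (k + 1))) ≤ θ)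
    {i j : ℤ} (hij : i ≤ j) (h1 : n - 2 ≤ w (i + 1)) (h2 : w j ≤ n + 2) :
    dist ((f ^ n) (a i)) ((f ^ n) (a j)) ≤ (4 / κ + 1) * θ := by
  have wmono := strictMono_of_step hκ hw
  have key : dist ((f ^ n) (a i)) ((f ^ n) (a j)) ≤ (j - i) * θ := by
    induction j, hij using Int.leInduction with
    | base => simp
    | succ j hij ih =>
      have e1 := ih ((wmono (lt_add_one j)).le.trans h2)
      have e2 := hj j (h1.trans (wmono.monotone (by lia))) h2
      push_cast
      linarith [dist_triangle ((f ^ n) (a i)) ((f ^ n) (a j)) ((f ^ n) (a (j + 1)))]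
  refine key.trans (mul_le_mul_of_nonneg_right ?_ hθ)
  rcases hij.eq_or_lt with rfl | hlt
  · rw [sub_self]
    positivity
  · have := mul_le_sub_of_step hw (show i + 1 ≤ j from hlt)
    push_cast at this
    have h3 : (j - (i + 1) : ℝ) ≤ 4 / κ := by
      rw [le_div_iff₀ hκ]
      linarith
    linarith

variable {X : Type*} [MetricSpace X] [CompactSpace X] {f : X ≃ₜ X} {τ : C(X, Set.Ioi (0 : ℝ))}

/-- The height reached after time `t` from the height `w` along the orbit of `(x, 0)`. -/
noncomputable def advance (f : X ≃ₜ X) (τ : C(X, Set.Ioi (0 : ℝ))) (x : X) (w t : ℝ) : ℝ :=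
  (heightIso f τ x).symm (heightIso f τ x w + t)

theorem flow_cover_advance (x : X) (w t : ℝ) :
    (flow f τ).toFun t (cover f τ x w) = cover f τ x (advance f τ x w t) :=
  flow_cover x w t

theorem advance_zero (x : X) (w : ℝ) : advance f τ x w 0 = w := by
  simp [advance]

theorem advance_eq_iff {x : X} {w v t : ℝ} :
    advance f τ x w t = v ↔ t = heightIso f τ x v - heightIso f τ x w := by
  unfold advance
  rw [OrderIso.symm_apply_eq, eq_sub_iff_add_eq']

theorem advance_strictMono (x : X) (w : ℝ) : StrictMono (advance f τ x w) :=
  fun _ _ h => (heightIso f τ x).symm.strictMono (by linarith)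

theorem advance_surjective (x : X) (w : ℝ) : Function.Surjective (advance f τ x w) :=
  fun _ => ⟨_, advance_eq_iff.mpr rfl⟩

theorem le_advance_sub {c M : ℝ} (hM : 0 < M)
    (hb : ∀ x, c ≤ (τ x : ℝ) ∧ (τ x : ℝ) ≤ M) (x : X) (w : ℝ) {t : ℝ} (ht : 1 ≤ t) :
    1 / M ≤ advance f τ x w t - w := by
  have h0 : w ≤ advance f τ x w t := by
    conv_lhs => rw [← advance_zero (f := f) (τ := τ) x w]
    exact (advance_strictMono x w).monotone (by linarith)
  have h := (heightIso_sub_bounds (f := f) hb x h0).2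
  rw [← advance_eq_iff.mp (rfl : advance f τ x w t = _)] at h
  rw [div_le_iff₀ hM]
  linarith

/-- A pseudo-orbit of the suspension flow lifts to a sequence in the cover whose jumps are small
in both coordinates. -/
theorem exists_lifted_pseudoOrbit {δ δ' : ℝ} (h : δ < δ') (h' : δ' ≤ 1 / 4)
    {P : ℤ → Suspension f τ} {t : ℤ → ℝ} (hP : (flow f τ).IsPseudoOrbit δ 1 P t) {x : X} {w₀ : ℝ}
    (h₀ : cover f τ x w₀ = P 0) :
    ∃ (a : ℤ → X) (w : ℤ → ℝ), a 0 = x ∧ w 0 = w₀ ∧ (∀ i, cover f τ (a i) (w i) = P i) ∧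
      ∀ i, |w (i + 1) - advance f τ (a i) (w i) (t i)| ≤ δ' ∧
        ∃ m : ℤ, |advance f τ (a i) (w i) (t i) - m| ≤ 1 ∧
          dist ((f ^ m) (a i)) ((f ^ m) (a (i + 1))) ≤ 4 * δ' := by
  obtain ⟨b, hb0, hb, hb'⟩ := exists_int_seq (α := X × ℝ)
    (fun i b => cover f τ b.1 b.2 = P i)
    (fun i b b' => |b'.2 - advance f τ b.1 b.2 (t i)| ≤ δ' ∧
        ∃ m : ℤ, |advance f τ b.1 b.2 (t i) - m| ≤ 1 ∧
          dist ((f ^ m) b.1) ((f ^ m) b'.1) ≤ 4 * δ')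
    (fun i b hb => by
      have hd := (hP i).2.trans_lt h
      rw [← hb, flow_cover_advance] at hd
      obtain ⟨y, v, hy, hv, hyd⟩ := exists_cover_of_dist_lt hd (abs_sub_round _) h'
      exact ⟨(y, v), hy, hv, _, (abs_sub_round _).trans (by norm_num), hyd⟩)
    -- Backward, lift the endpoint of the flight near `b` and flow back for time `t i`. Here `m`
    -- rounds the height after the jump, not before it, which is why the statement allows distance
    -- `1` from `m`.
    (fun i b hb => by
      have hd := (hP i).2.trans_lt h
      rw [dist_symm, ← hb] at hd
      obtain ⟨y, v, hy, hv, hyd⟩ := exists_cover_of_dist_lt hd (abs_sub_round _) h'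
      obtain ⟨w, rfl⟩ : ∃ w, advance f τ y w (t i) = v :=
        ⟨advance f τ y v (-t i), by
          rw [advance_eq_iff]
          have := advance_eq_iff.mp (rfl : advance f τ y v (-t i) = _)
          linarith⟩
      refine ⟨(y, w), ?_, by rw [abs_sub_comm]; exact hv, round b.2, ?_, by rwa [dist_comm]⟩
      · rw [← flow_cover_advance] at hy
        have hy' := congrArg ((flow f τ).toFun (-t i)) hy
        rwa [RealFlow.map_add, RealFlow.map_add, add_neg_cancel, RealFlow.map_zero,
          RealFlow.map_zero] at hy'
      · have := abs_sub_round b.2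
        have := abs_sub_le (advance f τ y w (t i)) b.2 (round b.2)
        simp only
        linarith)
    (x, w₀) h₀
  exact ⟨fun i => (b i).1, fun i => (b i).2, by simp [hb0], by simp [hb0], hb, hb'⟩

/-! ### The two inclusions -/

theorem cover_mem_shadowableSet {x : X} {w₀ : ℝ} (hw0 : 0 ≤ w₀) (hw1 : w₀ ≤ 1)
    (hx : x ∈ _root_.shadowableSet f) : cover f τ x w₀ ∈ (flow f τ).shadowableSet := by
  intro ε hε
  obtain ⟨c, M, hc, hM, hb⟩ := exists_roof_bounds τ
  obtain ⟨δf, hδf, Hf⟩ := hx (ε / 4) (by linarith)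
  -- A flight raises the height by at least `1 / M`; a jump may lose at most half of this.
  obtain ⟨κ, hκ, hκM⟩ : ∃ κ : ℝ, 0 < κ ∧ 2 * κ = 1 / M := ⟨1 / M / 2, by positivity, by ring⟩
  obtain ⟨η, hη, hηf, hηε⟩ : ∃ η : ℝ, 0 < η ∧ η ≤ δf ∧ η ≤ ε / 4 :=
    ⟨min δf (ε / 4), by positivity, min_le_left _ _, min_le_right _ _⟩
  obtain ⟨θ, hθ, hθη⟩ : ∃ θ : ℝ, 0 < θ ∧ (4 / κ + 1) * θ = η :=
    ⟨η / (4 / κ + 1), by positivity, by field_simp⟩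
  -- Jumps are controlled after `f^m`, with `m` within `1` of the height before the jump, but are
  -- needed after `f^n`, with `n` within `2` of the height after it; so `|n - m| ≤ 3`.
  obtain ⟨δm, hδm, Hm⟩ := exists_modulus f 3 hθ
  obtain ⟨δ', hδ', h8, hδκ, hδδm, hδε⟩ :
      ∃ δ' : ℝ, 0 < δ' ∧ δ' ≤ 1 / 8 ∧ δ' ≤ κ ∧ 4 * δ' ≤ δm ∧ δ' ≤ ε / 4 :=
    ⟨min (min (1 / 8) κ) (min (δm / 4) (ε / 4)), by positivity,
      (min_le_left _ _).trans (min_le_left _ _), (min_le_left _ _).trans (min_le_right _ _),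
      by linarith [(min_le_right (min (1 / 8) κ) (min (δm / 4) (ε / 4))).trans (min_le_left _ _)],
      (min_le_right _ _).trans (min_le_right _ _)⟩
  refine ⟨δ' / 2, half_pos hδ', fun P t hP hP0 => ?_⟩
  obtain ⟨a, w, ha0, hw00, hcov, hjump⟩ :=
    exists_lifted_pseudoOrbit (half_lt_self hδ') (by linarith) hP hP0.symm
  set w' : ℤ → ℝ := fun i => advance f τ (a i) (w i) (t i) with hw'
  have hadv : ∀ i, 2 * κ ≤ w' i - w i := fun i =>
    hκM ▸ le_advance_sub hM hb (a i) (w i) (hP i).1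
  have hnear : ∀ i, -δ' ≤ w (i + 1) - w' i ∧ w (i + 1) - w' i ≤ δ' := fun i =>
    abs_le.mp (hjump i).1
  have hstep : ∀ i, w i + κ ≤ w (i + 1) := fun i => by linarith [hadv i, hnear i]
  have wmono := strictMono_of_step hκ hstep
  have hclose : ∀ (n i j : ℤ), i ≤ j → n - 2 ≤ w (i + 1) → w j ≤ n + 2 →
      dist ((f ^ n) (a i)) ((f ^ n) (a j)) ≤ η := by
    intro n i j hij h1 h2
    rw [← hθη]
    refine dist_zpow_le_of_jumps hκ hθ.le hstep (fun k hk1 hk2 => ?_) hij h1 h2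
    obtain ⟨-, m, hm, hd⟩ := hjump k
    have hk := hnear k
    rw [abs_le] at hm
    have hmn : |n - m| ≤ (3 : ℕ) := by
      have h3 : ((n - m : ℤ) : ℝ) < (4 : ℤ) := by
        push_cast; simp only [hw'] at hk; linarith
      have h4 : ((-4 : ℤ) : ℝ) < ((n - m : ℤ) : ℝ) := by
        push_cast; simp only [hw'] at hk; linarith
      rw [abs_le]
      have h3' := Int.cast_lt.mp h3
      have h4' := Int.cast_lt.mp h4
      constructor <;> push_cast <;> lia
    have := Hm _ _ (hd.trans hδδm) (n - m) hmn
    rwa [← Homeomorph.mul_apply, ← Homeomorph.mul_apply, ← zpow_add, sub_add_cancel] at this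
  -- Sampling at heights `n + w₀` makes the sample for `n = 0` the point `x` itself.
  choose I hI hI' using fun n : ℤ => exists_le_lt_succ hκ hstep (n + w₀)
  have hI0 : I 0 = 0 := by
    have h1 := hI 0
    have h2 := hI' 0
    rw [Int.cast_zero, zero_add, ← hw00] at h1 h2
    have h3 := wmono.le_iff_le.mp h1
    have h4 := wmono.lt_iff_lt.mp h2
    lia
  obtain ⟨q, hq⟩ := Hf (fun n => (f ^ n) (a (I n))) (fun n => by
    have e : ∀ y, f ((f ^ n) y) = (f ^ (n + 1)) y := fun y => by
      rw [add_comm, zpow_one_add]; rfl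
    simp only [e]
    refine (hclose (n + 1) (I n) (I (n + 1)) ?_ ?_ ?_).trans hηf
    · have h1 := hI n
      have h2 := hI' (n + 1)
      push_cast at h2
      have h3 := wmono.lt_iff_lt.mp (show w (I n) < w (I (n + 1) + 1) by linarith)
      lia
    · push_cast; linarith [hI' n]
    · have := hI (n + 1)
      push_cast at this ⊢
      linarith) (by simp [hI0, ha0])
  have hs : ∀ i, sumSeq t i + 1 ≤ sumSeq t (i + 1) := fun i => by
    rw [sumSeq_succ]; linarith [(hP i).1]
  let A : ℤ → ℝ → ℝ := fun i r => advance f τ (a i) (w i) (r - sumSeq t i)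
  have hA0 : ∀ i, A i (sumSeq t i) = w i := fun i => by simp [A, advance_zero]
  have hA1 : ∀ i, A i (sumSeq t (i + 1)) = w' i := fun i => by simp [A, hw', sumSeq_succ]
  have hAmono : ∀ i, StrictMono (A i) := fun i r r' h =>
    advance_strictMono _ _ (by linarith)
  -- Rescaling each flight by `ρ i` makes it end at height `w (i + 1)` instead of `w' i`, so that
  -- the flights glue to a bijection `H` that differs from the true height by at most one jump.
  let ρ : ℤ → ℝ := fun i => (w (i + 1) - w i) / (w' i - w i)
  have hρ : ∀ i, 0 < ρ i := fun i =>
    div_pos (by linarith [hstep i]) (by linarith [hadv i])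
  have hρ' : ∀ i, (w' i - w i) * ρ i = w (i + 1) - w i := fun i =>
    mul_div_cancel₀ _ (by linarith [hadv i])
  obtain ⟨H, Hmono, Hsurj, HG⟩ := exists_glue one_pos hs hκ hstep
    (fun i r => w i + (A i r - w i) * ρ i)
    (fun i r r' h => by
      have := mul_lt_mul_of_pos_right (hAmono i h) (hρ i)
      simp only
      linarith)
    (fun i v => by
      obtain ⟨r, hr⟩ := advance_surjective (f := f) (τ := τ) (a i) (w i) (w i + (v - w i) / ρ i)
      refine ⟨r + sumSeq t i, ?_⟩
      simp only [A, add_sub_cancel_right, hr]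
      have := (hρ i).ne'
      field_simp
      ring)
    (fun i => by simp [hA0]) (fun i => by rw [hA1, hρ']; ring)
  refine ⟨cover f τ q w₀, fun r => heightIso f τ q (H r) - heightIso f τ q w₀,
    ⟨fun r r' h => ?_, fun v => ?_, ?_⟩, fun r i hr hr' => ?_⟩
  · have := (heightIso f τ q).strictMono (Hmono h)
    simp only
    linarith
  · obtain ⟨r, hr⟩ := Hsurj ((heightIso f τ q).symm (v + heightIso f τ q w₀))
    exact ⟨r, by simp [hr]⟩
  · have h1 := HG 0 0 (sumSeq_zero t).le (by linarith [hs 0, sumSeq_zero t])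
    have h2 := hA0 0
    rw [sumSeq_zero] at h2
    rw [h2, hw00] at h1
    simp [h1]
  · rw [← hcov i, flow_cover_advance, flow_cover_advance, advance_eq_iff.mpr rfl]
    change dist (cover f τ (a i) (A i r)) _ ≤ ε
    have hAl : w i ≤ A i r := hA0 i ▸ (hAmono i).monotone hr
    have hAu : A i r ≤ w' i := hA1 i ▸ (hAmono i).monotone hr'.le
    have hclose' : |A i r - H r| ≤ δ' := by
      have e : (A i r - H r) * (w' i - w i) = (A i r - w i) * (w' i - w (i + 1)) := by
        rw [HG i r hr hr'.le]
        linear_combination -(A i r - w i) * hρ' i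
      have hpos : 0 < w' i - w i := by linarith [hadv i]
      rw [← mul_le_mul_iff_left₀ hpos]
      calc |A i r - H r| * (w' i - w i) = |(A i r - H r) * (w' i - w i)| := by
            rw [abs_mul, abs_of_pos hpos]
        _ = (A i r - w i) * |w' i - w (i + 1)| := by
            rw [e, abs_mul, abs_of_nonneg (by linarith : 0 ≤ A i r - w i)]
        _ ≤ (w' i - w i) * δ' := by
            refine mul_le_mul (by linarith) ?_ (abs_nonneg _) hpos.le
            rw [abs_sub_comm]
            exact (hjump i).1
        _ = δ' * (w' i - w i) := mul_comm _ _
    have hbase : ∀ n : ℤ, ⌊A i r⌋ ≤ n → n ≤ ⌊A i r⌋ + 1 →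
        dist ((f ^ n) (a i)) ((f ^ n) q) ≤ ε / 2 := by
      intro n hn1 hn2
      have hn1' : A i r < n + 1 := by
        have : (⌊A i r⌋ : ℝ) ≤ n := by exact_mod_cast hn1
        linarith [Int.lt_floor_add_one (A i r)]
      have hn2' : (n : ℝ) - 1 ≤ A i r := by
        have : (n : ℝ) ≤ ⌊A i r⌋ + 1 := by exact_mod_cast hn2
        linarith [Int.floor_le (A i r)]
      have h1 : dist ((f ^ n) (a i)) ((f ^ n) (a (I n))) ≤ η := by
        rcases le_total i (I n) with h | h
        · exact hclose n _ _ h (by linarith [hnear i]) (by linarith [hI n])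
        · rw [dist_comm]
          exact hclose n _ _ h (by linarith [hI' n]) (by linarith)
      have h2 := hq n
      rw [dist_comm] at h2
      linarith [dist_triangle ((f ^ n) (a i)) ((f ^ n) (a (I n))) ((f ^ n) q)]
    have := dist_cover_le (τ := τ) (x := a i) (y := q) (w := A i r) (v := H r) (b := ε / 2)
      (by linarith) (hbase _ le_rfl (by lia)) (hbase _ (by lia) le_rfl)
    linarith

theorem mem_shadowableSet_of_cover {x : X} {w₀ : ℝ} (hw0 : 0 ≤ w₀) (hw1 : w₀ ≤ 1)
    (hx : cover f τ x w₀ ∈ (flow f τ).shadowableSet) : x ∈ _root_.shadowableSet f := by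
  intro ε hε
  obtain ⟨c, M, hc, hM, hb⟩ := exists_roof_bounds τ
  -- Rising by `k` floors takes time at least `k * c ≥ 1`.
  obtain ⟨k, hk⟩ := exists_nat_ge (1 / c)
  have hkc : 1 ≤ (k : ℝ) * c := (div_le_iff₀ hc).mp hk
  have hkpos : (0 : ℝ) < k := lt_of_lt_of_le (by positivity) hk
  obtain ⟨e, he, he8, heε⟩ : ∃ e : ℝ, 0 < e ∧ e ≤ 1 / 8 ∧ 4 * e ≤ ε / 2 :=
    ⟨min (1 / 8) (ε / 8), by positivity, min_le_left _ _,
      by linarith [min_le_right (1 / 8) (ε / 8)]⟩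
  obtain ⟨δ₁, hδ₁, H₁⟩ := hx (e / 2) (half_pos he)
  obtain ⟨δ, hδ, Hδ⟩ := exists_pseudoOrbit_modulus f (k + 2) (η := min (δ₁ / 2) (ε / 2))
    (by positivity)
  refine ⟨δ, hδ, fun z hz hz0 => ?_⟩
  have hzδ : ∀ (n : ℤ) (j : ℕ), j ≤ k + 2 → dist ((f ^ (j : ℤ)) (z n)) (z (n + j)) ≤ δ₁ / 2 :=
    fun n j hj => (Hδ z hz n j hj).trans (min_le_left _ _)
  have hzε : ∀ (n : ℤ) (j : ℕ), j ≤ k + 2 → dist ((f ^ (j : ℤ)) (z n)) (z (n + j)) ≤ ε / 2 :=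
    fun n j hj => (Hδ z hz n j hj).trans (min_le_right _ _)
  -- The orbit of `(a i, 0)` passes over `z (i * k)` at height `i * k`. Each flight ends exactly at
  -- height `w (i + 1)`, so all jumps are horizontal.
  let a : ℤ → X := fun i => (f ^ (-(i * k))) (z (i * k))
  have ha : ∀ i n, (f ^ n) (a i) = (f ^ (n - i * k)) (z (i * k)) := fun i n => by
    rw [sub_eq_add_neg, zpow_add]; rfl
  let w : ℤ → ℝ := fun i => w₀ + i * k
  have hstep : ∀ i, w i + k ≤ w (i + 1) := fun i => by
    simp only [w]; push_cast; linarith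
  let t : ℤ → ℝ := fun i => heightIso f τ (a i) (w (i + 1)) - heightIso f τ (a i) (w i)
  have ht : ∀ i, advance f τ (a i) (w i) (t i) = w (i + 1) := fun i => advance_eq_iff.mpr rfl
  have ht1 : ∀ i, 1 ≤ t i := fun i => by
    have := (heightIso_sub_bounds (f := f) hb (a i) (show w i ≤ w (i + 1) by linarith [hstep i])).1
    have h2 := mul_le_mul_of_nonneg_right
      (show (k : ℝ) ≤ w (i + 1) - w i by linarith [hstep i]) hc.le
    simp only [t]
    linarith
  have hjump : ∀ (i : ℤ) (j : ℕ), j ≤ 2 → dist ((f ^ ((i + 1) * k + j : ℤ)) (a i))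
      ((f ^ ((i + 1) * k + j : ℤ)) (a (i + 1))) ≤ δ₁ := by
    intro i j hj
    have h1 := hzδ (i * k) (k + j) (by lia)
    have h2 := hzδ ((i + 1) * k) j (by lia)
    rw [ha, ha]
    have e1 : (i + 1) * k + j - i * k = ((k + j : ℕ) : ℤ) := by push_cast; ring
    have e2 : (i + 1) * k + j - (i + 1) * k = (j : ℤ) := by ring
    have e3 : i * k + ((k + j : ℕ) : ℤ) = (i + 1) * k + j := by push_cast; ring
    rw [e1, e2]
    rw [e3] at h1
    linarith [dist_triangle_right ((f ^ ((k + j : ℕ) : ℤ)) (z (i * k)))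
      ((f ^ (j : ℤ)) (z ((i + 1) * k))) (z ((i + 1) * k + j))]
  have hpo : (flow f τ).IsPseudoOrbit δ₁ 1 (fun i => cover f τ (a i) (w i)) t := by
    intro i
    refine ⟨ht1 i, ?_⟩
    rw [flow_cover_advance, ht]
    -- The case `j = 1` covers `w₀ = 1`; with the next floor included, blocks of length up to `k +
    -- 2` must be controlled.
    obtain ⟨j, hj, hfl⟩ : ∃ j : ℕ, j ≤ 1 ∧ ⌊w (i + 1)⌋ = (i + 1) * k + j := by
      have e1 : ⌊w (i + 1)⌋ = (i + 1) * k + ⌊w₀⌋ := by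
        have : w (i + 1) = w₀ + (((i + 1) * k : ℤ) : ℝ) := by simp only [w]; push_cast; ring
        rw [this, Int.floor_add_intCast, add_comm]
      have e2 : 0 ≤ ⌊w₀⌋ := Int.floor_nonneg.mpr hw0
      have e3 : ⌊w₀⌋ ≤ 1 := by
        rw [← Int.floor_one (R := ℝ)]
        exact Int.floor_le_floor hw1
      exact ⟨⌊w₀⌋.toNat, by lia, by rw [e1, Int.toNat_of_nonneg e2]⟩
    have := dist_cover_le (f := f) (τ := τ) (x := a i) (y := a (i + 1)) (w := w (i + 1))
      (v := w (i + 1)) (b := δ₁) (by simp) (by rw [hfl]; exact hjump i j (by lia))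
      (by rw [hfl]; have := hjump i (j + 1) (by lia); push_cast at this; rwa [← add_assoc] at this)
    simpa using this
  have ha0 : a 0 = x := by simpa [hz0] using ha 0 0
  obtain ⟨y, h, ⟨hmono, hsurj, -⟩, hsh⟩ := H₁ _ t hpo (by simp [ha0, w])
  obtain ⟨q, u, -, rfl⟩ := exists_eq_cover y
  have hs : ∀ i, sumSeq t i + 1 ≤ sumSeq t (i + 1) := fun i => by
    rw [sumSeq_succ]; linarith [ht1 i]
  obtain ⟨A, Amono, Asurj, hA⟩ := exists_glue one_pos hs hkpos hstep
    (fun i r => advance f τ (a i) (w i) (r - sumSeq t i))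
    (fun i r r' h => advance_strictMono _ _ (by linarith))
    (fun i v => by
      obtain ⟨r, hr⟩ := advance_surjective (f := f) (τ := τ) (a i) (w i) v
      exact ⟨r + sumSeq t i, by simpa using hr⟩)
    (fun i => by simp [advance_zero]) (fun i => by simp [sumSeq_succ, ht])
  let B : ℝ → ℝ := fun r => advance f τ q u (h r)
  -- Lift the shadowing point at time `r` next to `(a i, A r)`; the lift `b` and the base point `q`
  -- differ by a deck transformation `l`, which a priori depends on `r`.
  have key : ∀ (r : ℝ) (m : ℤ), |A r - m| ≤ 1 / 2 → ∃ (i l : ℤ) (b : X),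
      sumSeq t i ≤ r ∧ r < sumSeq t (i + 1) ∧ |A r - B r - l| ≤ e ∧ q = (f ^ l) b ∧
        dist ((f ^ m) (a i)) ((f ^ m) b) ≤ 4 * e := by
    intro r m hm
    obtain ⟨i, hi, hi'⟩ := exists_le_lt_succ one_pos hs r
    have hd := hsh r i hi hi'
    rw [flow_cover_advance, flow_cover_advance, ← hA i r hi hi'.le] at hd
    obtain ⟨b, v, hbv, hv, hbd⟩ :=
      exists_cover_of_dist_lt (hd.trans_lt (half_lt_self he)) hm (by linarith)
    obtain ⟨l, hl, hvl⟩ := exists_of_cover_eq hbv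
    refine ⟨i, l, b, hi, hi', ?_, hl, hbd⟩
    rw [abs_sub_comm] at hv
    rwa [sub_sub, ← hvl]
  obtain ⟨N, hN⟩ := exists_int_near (g := fun r => A r - B r) (e := e)
    ((strictMono_surjective_continuous Amono Asurj).sub (strictMono_surjective_continuous
      ((advance_strictMono q u).comp hmono) ((advance_surjective q u).comp hsurj)))
    (by linarith)
    (fun r => by
      obtain ⟨-, l, -, -, -, hl, -⟩ := key r (round (A r)) (abs_sub_round _)
      exact ⟨l, hl⟩)
  refine ⟨(f ^ (-N)) q, fun n => ?_⟩
  -- At the time when the pseudo-orbit has height `n`, the lift `b` is `f^(-N) q`, and `f^n (a i)`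
  -- is an iterate of `z (i * k)` close to `z n`.
  obtain ⟨r, hr⟩ := Asurj n
  obtain ⟨i, l, b, hi, hi', hl, rfl, hbd⟩ := key r n (by simp [hr])
  obtain rfl : l = N := by
    have h1 := hN r
    rw [abs_le] at h1 hl
    have h2 : ((l - N : ℤ) : ℝ) < (1 : ℤ) := by push_cast; linarith
    have h3 : ((-1 : ℤ) : ℝ) < ((l - N : ℤ) : ℝ) := by push_cast; linarith
    have h2' := Int.cast_lt.mp h2
    have h3' := Int.cast_lt.mp h3
    lia
  have hq : (f ^ (-l)) ((f ^ l) b) = b := by simp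
  rw [hq]
  have hn1 : w i ≤ n := by
    have := Amono.monotone hi
    rwa [hr, hA i _ le_rfl (by linarith [hs i]), sub_self, advance_zero] at this
  have hn2 : n ≤ w (i + 1) := by
    have := Amono.monotone hi'.le
    rwa [hr, hA i _ (by linarith [hs i]) le_rfl, sumSeq_succ, add_sub_cancel_left, ht] at this
  obtain ⟨j, hj⟩ : ∃ j : ℕ, n - i * k = (j : ℤ) := by
    apply Int.eq_ofNat_of_zero_le
    have : ((i * k : ℤ) : ℝ) ≤ n := by push_cast; simp only [w] at hn1; linarith
    have := Int.cast_le.mp this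
    lia
  have hjk : j ≤ k + 2 := by
    have h1 : (n : ℝ) - i * k = j := by exact_mod_cast hj
    have h2 : (j : ℝ) ≤ ((k + 2 : ℕ) : ℝ) := by
      push_cast
      simp only [w] at hn2
      push_cast at hn2
      linarith
    exact_mod_cast h2
  have h1 := hzε (i * k) j hjk
  rw [ha, hj] at hbd
  rw [← hj, add_sub_cancel, hj] at h1
  rw [dist_comm] at hbd
  linarith [dist_triangle ((f ^ n) b) ((f ^ (j : ℤ)) (z (i * k))) (z n)]

end Suspension

theorem theorem2p3 {X : Type*} [MetricSpace X] [CompactSpace X] (f : X ≃ₜ X)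
    (τ : C(X, Set.Ioi (0 : ℝ))) :
    (Suspension.flow f τ).shadowableSet =
      {p : Suspension f τ | ∃ (x : X) (s : ℝ) (h0 : 0 ≤ s) (h1 : s ≤ τ x),
        x ∈ shadowableSet f ∧ p = Suspension.mk f τ x s h0 h1} := by
  ext p
  constructor
  · intro hp
    obtain ⟨x, u, h1, h2⟩ := Suspension.exists_eq_cover p
    rw [h2] at hp
    exact ⟨x, _, _, _, Suspension.mem_shadowableSet_of_cover u.2.1 u.2.2 hp, h1⟩
  · rintro ⟨x, s, h0, h1, hx, rfl⟩
    have hpos : (0 : ℝ) < τ x := (τ x).2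
    have hu0 : 0 ≤ s / τ x := div_nonneg h0 hpos.le
    have hu1 : s / τ x ≤ 1 := (div_le_one hpos).mpr h1
    have e : Suspension.mk f τ x s h0 h1 = Suspension.cover f τ x (s / τ x) := by
      have h := Suspension.cover_of_mem (f := f) (τ := τ) x ⟨s / τ x, hu0, hu1⟩
      rw [h]
      unfold Suspension.atHeight
      congr 1
      exact (div_mul_cancel₀ s hpos.ne').symm
    rw [e]
    exact Suspension.cover_mem_shadowableSet hu0 hu1 hx
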